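/- Consider a power network: a connected undirected simple graph $\mathcal G=(\mathcal V,\mathcal E)$ with $\mathcal V=\mathcal V_{\rm G}\sqcup\mathcal V_{\rm L}$, where $\mathcal V_{\rm G}=\{1,\dots,N_{\rm G}\}$ ($N_{\rm G}\ge 1$) are generators and $\mathcal V_{\rm L}=\{N_{\rm G}+1,\dots,N\}$, $N=N_{\rm G}+N_{\rm L}$, are loads. Let $E=|\mathcal E|$, let $\mathbf C\in\mathbb R^{N\times E}$ be a signed incidence matrix of $\mathcal G$, and let $\mathbf B=\mathrm{diag}(b_1,\dots,b_E)$ with all $b_e>0$. Vector inequalities are meant entrywise (strict ones in every entry), and $\|\cdot\|_0$ is the number of nonzero entries. Given limits $\xi=(\overline{\mathbf s}^g,\underline{\mathbf s}^g,\overline{\mathbf p},\underline{\mathbf p})$ with $\overline{\mathbf s}^g>\underline{\mathbf s}^g\ge 0$ and $\overline{\mathbf p}>\underline{\mathbf p}$, a cost vector $\mathbf f\in\mathbb R^{N_{\rm G}}$ and a load vector $\mathbf s^l\in\mathbb R^{N_{\rm L}}$, consider the DC optimal power flow problem $$\min_{\mathbf s^g,\theta}\ \mathbf f^{\mathsf T}\mathbf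 s^g\quad\text{s.t.}\quad \theta_1=0,\quad \mathbf C\mathbf B\mathbf C^{\mathsf T}\theta=\begin{bmatrix}\mathbf s^g\\-\mathbf s^l\end{bmatrix},\quad \underline{\mathbf s}^g\le\mathbf s^g\le\overline{\mathbf s}^g,\quad \underline{\mathbf p}\le\mathbf B\mathbf C^{\mathsf T}\theta\le\overline{\mathbf p}.\qquad(1)$$ Let $\Omega_{\mathbf s^l}$ be the set of $\mathbf s^l>0$ for which (1) is feasible, assumed nonempty, and let $\mathcal{OPF}(\mathbf s^l)$ be the optimal $\mathbf s^g$ in (1). Assume that for every $\mathbf s^l\in\Omega_{\mathbf s^l}$ the optimal solution of (1) is unique, and that all Lagrange multipliers $\lambda_\pm$ (of the upper and lower generation limits) and $\mu_\pm$ (of the upper and lower flow limits) satisfying the KKT conditions of (1) satisfy $\|\mu_+\|_0+\|\mu_-\|_0+\|\lambda_+\|_0+\|\lambda_-\|_0\ge N_{\rm G}-1$. Let $\widetilde\Omega_{\mathbf s^l}$ be the set of $\mathbf s^l\in\Omega_{\mathbf s^l}$ for which exactly $N_{\rm G}-1$ of the inequality constraints of (1) are binding at the optimal solution, and assume that $\widetilde\Omega_{\mathbf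 s^l}$ is dense in $\Omega_{\mathbf s^l}$. Call $e\in\mathcal E$ a bottleneck if there is $\mathbf s^l\in\widetilde\Omega_{\mathbf s^l}$ such that the optimal branch flow $\mathbf p=\mathbf B\mathbf C^{\mathsf T}\theta$ in (1) satisfies $\mathbf p_e\in\{\underline{\mathbf p}_e,\overline{\mathbf p}_e\}$, and a bridge if $(\mathcal V,\mathcal E\setminus\{e\})$ is not connected. If every bottleneck is a bridge, then the system is monotone: for all $\alpha,\beta\in\Omega_{\mathbf s^l}$ with $\alpha\ge\beta$ and $\|\alpha-\beta\|_0=1$, one has $\mathcal{OPF}(\alpha)\ge\mathcal{OPF}(\beta)$ entrywise. -/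

import Mathlib

open scoped Matrix

noncomputable section

/-- The buses: generators `Sum.inl i` and loads `Sum.inr j`; no bus is both. -/
abbrev Bus (nG nL : ℕ) : Type := Fin nG ⊕ Fin nL

/-- A power network: a connected undirected graph on the buses, whose edges are labelled by
`Fin nE` and carry an (arbitrary) orientation and a positive susceptance. -/
structure PowerNetwork (nG nL nE : ℕ) where
  graph : SimpleGraph (Bus nG nL)
  connected : graph.Connected
  edge : Fin nE ≃ graph.edgeSet
  src : Fin nE → Bus nG nL
  dst : Fin nE → Bus nG nL
  edge_eq : ∀ e, (edge e : Sym2 (Bus nG nL)) = s(src e, dst e)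
  b : Fin nE → ℝ
  b_pos : ∀ e, 0 < b e

/-- Limits for the generations and for the branch power flows. -/
structure SystemLimits (nG nE : ℕ) where
  sgMax : Fin nG → ℝ
  sgMin : Fin nG → ℝ
  pMax : Fin nE → ℝ
  pMin : Fin nE → ℝ

/-- Well-posedness: strict inequality between lower and upper limits in every coordinate. -/
def SystemLimits.WellPosed {nG nE : ℕ} (ξ : SystemLimits nG nE) : Prop :=
  (∀ i, ξ.sgMin i < ξ.sgMax i) ∧ (∀ e, ξ.pMin e < ξ.pMax e)

namespace PowerNetwork

variable {nG nL nE : ℕ}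

/-- The signed incidence matrix `C`. -/
def incidence (P : PowerNetwork nG nL nE) : Matrix (Bus nG nL) (Fin nE) ℝ :=
  Matrix.of fun v e => if v = P.src e then 1 else if v = P.dst e then -1 else 0

/-- The weighted Laplacian `C B Cᵀ`. -/
def laplacian (P : PowerNetwork nG nL nE) : Matrix (Bus nG nL) (Bus nG nL) ℝ :=
  P.incidence * Matrix.diagonal P.b * P.incidenceᵀ

/-- The branch power flows `p = B Cᵀ θ`. -/
def flow (P : PowerNetwork nG nL nE) (θ : Bus nG nL → ℝ) : Fin nE → ℝ :=
  (Matrix.diagonal P.b * P.incidenceᵀ) *ᵥ θ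

/-- The slack bus: the first generator. -/
def slack (_P : PowerNetwork nG nL nE) [NeZero nG] : Bus nG nL := Sum.inl 0

/-- Bridges: edges whose removal disconnects the graph. -/
def bridges (P : PowerNetwork nG nL nE) : Set (Fin nE) :=
  {e | ¬ (P.graph.deleteEdges {(P.edge e : Sym2 (Bus nG nL))}).Connected}

/-- The constraints of the DC optimal power flow problem with load vector `sl`, for the decision
variables: generations `sg` and voltage angles `θ`. -/
structure Feasible [NeZero nG] (P : PowerNetwork nG nL nE) (ξ : SystemLimits nG nE)
    (sl : Fin nL → ℝ) (sg : Fin nG → ℝ) (θ : Bus nG nL → ℝ) : Prop where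
  slack_angle : θ P.slack = 0
  balance : P.laplacian *ᵥ θ = Sum.elim sg (fun j => - sl j)
  gen_lower : ξ.sgMin ≤ sg
  gen_upper : sg ≤ ξ.sgMax
  flow_lower : ξ.pMin ≤ P.flow θ
  flow_upper : P.flow θ ≤ ξ.pMax

/-- `(sg, θ)` is an optimal solution of: minimize `fᵀ sg` subject to the constraints. -/
def IsOptimal [NeZero nG] (P : PowerNetwork nG nL nE) (ξ : SystemLimits nG nE)
    (f : Fin nG → ℝ) (sl : Fin nL → ℝ) (sg : Fin nG → ℝ) (θ : Bus nG nL → ℝ) : Prop :=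
  P.Feasible ξ sl sg θ ∧
    ∀ (sg' : Fin nG → ℝ) (θ' : Bus nG nL → ℝ), P.Feasible ξ sl sg' θ' → f ⬝ᵥ sg ≤ f ⬝ᵥ sg'

/-- `Ω_{s^l}(ξ)`: the strictly positive loads for which the problem is feasible. -/
def loadSet [NeZero nG] (P : PowerNetwork nG nL nE) (ξ : SystemLimits nG nE) :
    Set (Fin nL → ℝ) :=
  {sl | (∀ j, 0 < sl j) ∧ ∃ sg θ, P.Feasible ξ sl sg θ}

/-- `Ω`: limits with nonnegative lower generation limits, feasible for some positive load. -/
def limitSet [NeZero nG] (P : PowerNetwork nG nL nE) : Set (SystemLimits nG nE) :=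
  {ξ | (∀ i, 0 ≤ ξ.sgMin i) ∧ (P.loadSet ξ).Nonempty}

/-- `OPF(sl)`, set valued: the optimal generation vectors. -/
def opf [NeZero nG] (P : PowerNetwork nG nL nE) (ξ : SystemLimits nG nE) (f : Fin nG → ℝ)
    (sl : Fin nL → ℝ) : Set (Fin nG → ℝ) :=
  {sg | ∃ θ, P.IsOptimal ξ f sl sg θ}

/-- The KKT conditions at `(sg, θ)`. The multiplier of the power balance is `τ`, that of the slack
bus constraint is `τ₀`; `lamP, lamM` belong to the upper and lower generation limits and
`muP, muM` to the upper and lower flow limits. -/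
structure KKT [NeZero nG] (P : PowerNetwork nG nL nE) (ξ : SystemLimits nG nE)
    (f : Fin nG → ℝ) (sl : Fin nL → ℝ) (sg : Fin nG → ℝ) (θ : Bus nG nL → ℝ)
    (τ : Bus nG nL → ℝ) (τ₀ : ℝ) (lamP lamM : Fin nG → ℝ) (muP muM : Fin nE → ℝ) : Prop where
  feasible : P.Feasible ξ sl sg θ
  stat_angle : P.laplacianᵀ *ᵥ τ + Pi.single P.slack τ₀
    + (P.incidence * Matrix.diagonal P.b) *ᵥ (muP - muM) = 0
  stat_gen : - f = - (fun i => τ (Sum.inl i)) + lamP - lamM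
  muP_nonneg : 0 ≤ muP
  muM_nonneg : 0 ≤ muM
  lamP_nonneg : 0 ≤ lamP
  lamM_nonneg : 0 ≤ lamM
  slack_muP : muP ⬝ᵥ (P.flow θ - ξ.pMax) = 0
  slack_muM : muM ⬝ᵥ (ξ.pMin - P.flow θ) = 0
  slack_lamP : lamP ⬝ᵥ (sg - ξ.sgMax) = 0
  slack_lamM : lamM ⬝ᵥ (ξ.sgMin - sg) = 0

/-- `Ω_f`: the cost vectors for which, for every load in `Ω_{s^l}`, the optimal solution is unique
and all KKT multipliers have at least `nG - 1` nonzero entries in total. -/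
def costSet [NeZero nG] (P : PowerNetwork nG nL nE) (ξ : SystemLimits nG nE) :
    Set (Fin nG → ℝ) :=
  {f | ∀ sl ∈ P.loadSet ξ,
    (∃! x : (Fin nG → ℝ) × (Bus nG nL → ℝ), P.IsOptimal ξ f sl x.1 x.2) ∧
    ∀ sg θ τ τ₀ lamP lamM muP muM, P.KKT ξ f sl sg θ τ τ₀ lamP lamM muP muM →
      nG ≤ hammingNorm muP + hammingNorm muM + hammingNorm lamP + hammingNorm lamM + 1}

/-- The generators that are at one of their limits. -/
def bindingGens (ξ : SystemLimits nG nE) (sg : Fin nG → ℝ) : Set (Fin nG) :=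
  {i | sg i = ξ.sgMin i ∨ sg i = ξ.sgMax i}

/-- The branches whose flow is at one of its limits. -/
def bindingBranches (P : PowerNetwork nG nL nE) (ξ : SystemLimits nG nE)
    (θ : Bus nG nL → ℝ) : Set (Fin nE) :=
  {e | P.flow θ e = ξ.pMin e ∨ P.flow θ e = ξ.pMax e}

/-- The loads in `Ω_{s^l}` at whose optimal solution exactly `nG - 1` inequalities bind. (For
well-posed limits, the lower and upper limit of a generator or branch never bind together.) -/
def regularLoadSet [NeZero nG] (P : PowerNetwork nG nL nE) (ξ : SystemLimits nG nE)
    (f : Fin nG → ℝ) : Set (Fin nL → ℝ) :=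
  {sl | sl ∈ P.loadSet ξ ∧ ∃ sg θ, P.IsOptimal ξ f sl sg θ ∧
    (bindingGens ξ sg).ncard + (P.bindingBranches ξ θ).ncard + 1 = nG}

/-- The possible branch flow bottlenecks. -/
def bottlenecks [NeZero nG] (P : PowerNetwork nG nL nE) (ξ : SystemLimits nG nE)
    (f : Fin nG → ℝ) : Set (Fin nE) :=
  {e | ∃ sl ∈ P.regularLoadSet ξ f, ∃ sg θ, P.IsOptimal ξ f sl sg θ ∧
    e ∈ P.bindingBranches ξ θ}

/-- The system is monotone: raising a single load lowers no optimal generation. -/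
def IsMonotone [NeZero nG] (P : PowerNetwork nG nL nE) (ξ : SystemLimits nG nE)
    (f : Fin nG → ℝ) : Prop :=
  ∀ α ∈ P.loadSet ξ, ∀ β ∈ P.loadSet ξ, β ≤ α → hammingNorm (α - β) = 1 →
    ∀ a ∈ P.opf ξ f α, ∀ b ∈ P.opf ξ f β, b ≤ a

end PowerNetwork

end

open scoped Matrix
open Filter Topology

/-! ### Network flows and the kernel of the Laplacian -/

namespace PowerNetwork

variable {nG nL nE : ℕ}

/-! The core is an exchange argument between two loads `β ≤ α` whose optima `b`, `a` have only
bridges among their binding branches. Suppose `a i < b i`. The angle difference `θa - θb` has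
injection `a - b` at generators and a nonpositive one at loads, so the negative injection at `i`
must be fed, along a path of strictly descending angle difference, by some generator `k` with `a k >
b k` (`exists_pos_of_neg`). Move one unit of generation from `k` to `i` at `a`, and from `i` to `k`
at `b`. No binding generation limit is violated, since each of `a i`, `a k` moves towards `b i`, `b
k` and conversely. The flow change on a bridge is fixed by topology alone, and the descending path
forces its sign to oppose that of the flow difference (`transfer_opposes_flow`), so binding bridges
are respected too. Optimality of `b` shows that the transfer at `a` does not raise the cost, which
contradicts uniqueness of the optimum at `a` (`IsOptimal.le_of_bridges`).

For arbitrary loads, both are approximated by regular ones with the order kept. Regular loads are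
interior to the feasible loads (`loadSet_mem_nhds`), so there is a feasible ball; mixing `α` with
its upper part and `β` with its lower part leaves room for the perturbation that density requires.
Optimal generations converge along such mixtures by compactness and uniqueness
(`IsOptimal.tendsto_of_convex_comb`), and the inequality passes to the limit. -/

theorem adj_src_dst (P : PowerNetwork nG nL nE) (e : Fin nE) :
    P.graph.Adj (P.src e) (P.dst e) := by
  have h := (P.edge e).2
  rwa [P.edge_eq, SimpleGraph.mem_edgeSet] at h

theorem exists_edge_of_adj (P : PowerNetwork nG nL nE) {v w : Bus nG nL}
    (h : P.graph.Adj v w) :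
    ∃ e, s(P.src e, P.dst e) = s(v, w) := by
  refine ⟨P.edge.symm ⟨s(v, w), h⟩, ?_⟩
  rw [← P.edge_eq, Equiv.apply_symm_apply]

theorem incidence_apply (P : PowerNetwork nG nL nE) (v : Bus nG nL) (e : Fin nE) :
    P.incidence v e = (if v = P.src e then 1 else 0) - (if v = P.dst e then 1 else 0) := by
  have h := (P.adj_src_dst e).ne
  simp only [incidence, Matrix.of_apply]
  by_cases h1 : v = P.src e
  · have h2 : v ≠ P.dst e := h1 ▸ h
    rw [if_pos h1, if_pos h1, if_neg h2, sub_zero]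
  · rw [if_neg h1, if_neg h1]
    split_ifs <;> simp

theorem flow_apply (P : PowerNetwork nG nL nE) (θ : Bus nG nL → ℝ) (e : Fin nE) :
    P.flow θ e = P.b e * (θ (P.src e) - θ (P.dst e)) := by
  rw [flow, ← Matrix.mulVec_mulVec, Matrix.mulVec_diagonal]
  congr 1
  simp only [Matrix.mulVec, dotProduct, Matrix.transpose_apply, incidence_apply, sub_mul,
    ite_mul, one_mul, zero_mul, Finset.sum_sub_distrib, Finset.sum_ite_eq', Finset.mem_univ,
    if_true]

theorem flow_add (P : PowerNetwork nG nL nE) (θ η : Bus nG nL → ℝ) :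
    P.flow (θ + η) = P.flow θ + P.flow η := Matrix.mulVec_add _ _ _

theorem flow_sub (P : PowerNetwork nG nL nE) (θ η : Bus nG nL → ℝ) :
    P.flow (θ - η) = P.flow θ - P.flow η := Matrix.mulVec_sub _ _ _

theorem flow_smul (P : PowerNetwork nG nL nE) (c : ℝ) (θ : Bus nG nL → ℝ) :
    P.flow (c • θ) = c • P.flow θ := Matrix.mulVec_smul _ _ _

theorem continuous_flow (P : PowerNetwork nG nL nE) : Continuous P.flow :=
  Continuous.matrix_mulVec continuous_const continuous_id

/-- The net injection into a set of buses is the net flow leaving it. -/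
theorem sum_laplacian_mulVec (P : PowerNetwork nG nL nE) (θ : Bus nG nL → ℝ)
    (S : Finset (Bus nG nL)) :
    ∑ v ∈ S, (P.laplacian *ᵥ θ) v =
      ∑ e, ((if P.src e ∈ S then 1 else 0) - (if P.dst e ∈ S then 1 else 0)) * P.flow θ e := by
  have h : P.laplacian *ᵥ θ = P.incidence *ᵥ P.flow θ := by
    rw [laplacian, flow, Matrix.mulVec_mulVec, Matrix.mul_assoc]
  rw [h]
  simp only [Matrix.mulVec, dotProduct]
  rw [Finset.sum_comm]
  refine Finset.sum_congr rfl fun e _ => ?_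
  rw [← Finset.sum_mul]
  simp only [incidence_apply, Finset.sum_sub_distrib, Finset.sum_ite_eq']

theorem sum_univ_laplacian_mulVec (P : PowerNetwork nG nL nE) (θ : Bus nG nL → ℝ) :
    ∑ v, (P.laplacian *ᵥ θ) v = 0 := by
  rw [sum_laplacian_mulVec]
  simp

/-- The quadratic form of the Laplacian vanishes only at constant angle vectors. -/
theorem eq_of_laplacian_mulVec_eq_zero (P : PowerNetwork nG nL nE) {θ : Bus nG nL → ℝ}
    (h : P.laplacian *ᵥ θ = 0) (v w : Bus nG nL) : θ v = θ w := by
  have hq : ∑ e, P.b e * (θ (P.src e) - θ (P.dst e)) ^ 2 = 0 := by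
    have h1 : θ ⬝ᵥ (P.incidence *ᵥ P.flow θ) = 0 := by
      rw [flow, Matrix.mulVec_mulVec, ← Matrix.mul_assoc, ← laplacian, h, dotProduct_zero]
    rw [← h1, Matrix.dotProduct_mulVec]
    refine Finset.sum_congr rfl fun e _ => ?_
    have : (θ ᵥ* P.incidence) e = θ (P.src e) - θ (P.dst e) := by
      simp [Matrix.vecMul, dotProduct, incidence_apply, mul_sub]
    rw [this, flow_apply]
    ring
  rw [Finset.sum_eq_zero_iff_of_nonneg
    fun e _ => mul_nonneg (P.b_pos e).le (sq_nonneg _)] at hq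
  have hadj : ∀ x y, P.graph.Adj x y → θ x = θ y := by
    intro x y hxy
    obtain ⟨e, he⟩ := P.exists_edge_of_adj hxy
    have h2 : θ (P.src e) = θ (P.dst e) := by
      have := hq e (Finset.mem_univ e)
      rcases mul_eq_zero.1 this with h3 | h3
      · exact absurd h3 (P.b_pos e).ne'
      · exact sub_eq_zero.1 (pow_eq_zero_iff two_ne_zero |>.1 h3)
    rcases Sym2.eq_iff.1 he with ⟨rfl, rfl⟩ | ⟨rfl, rfl⟩
    · exact h2
    · exact h2.symm
  obtain ⟨p⟩ := P.connected.preconnected v w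
  induction p with
  | nil => rfl
  | cons h _ ih => exact (hadj _ _ h).trans ih

/-! ### Angles as a linear function of injections; perturbing feasible points -/

variable [NeZero nG]

/-- The Laplacian, made invertible by adding the slack angle to the slack entry. -/
noncomputable def groundedLaplacian (P : PowerNetwork nG nL nE) :
    (Bus nG nL → ℝ) →ₗ[ℝ] (Bus nG nL → ℝ) :=
  P.laplacian.mulVecLin +
    (LinearMap.single ℝ (fun _ : Bus nG nL => ℝ) P.slack).comp (LinearMap.proj P.slack)

theorem groundedLaplacian_apply (P : PowerNetwork nG nL nE) (θ : Bus nG nL → ℝ) :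
    P.groundedLaplacian θ = P.laplacian *ᵥ θ + Pi.single P.slack (θ P.slack) := rfl

theorem sum_groundedLaplacian (P : PowerNetwork nG nL nE) (θ : Bus nG nL → ℝ) :
    ∑ v, P.groundedLaplacian θ v = θ P.slack := by
  simp only [groundedLaplacian_apply, Pi.add_apply, Finset.sum_add_distrib,
    sum_univ_laplacian_mulVec, zero_add, Finset.sum_pi_single', Finset.mem_univ, if_true]

/-- Summing the entries of the image isolates the slack angle, so on the kernel it vanishes; what
remains is a Laplacian kernel vector, which is constant. -/
theorem groundedLaplacian_injective (P : PowerNetwork nG nL nE) :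
    Function.Injective P.groundedLaplacian := by
  rw [injective_iff_map_eq_zero]
  intro θ h
  have h0 : θ P.slack = 0 := by rw [← P.sum_groundedLaplacian θ, h]; simp
  have h1 : P.laplacian *ᵥ θ = 0 := by
    rw [groundedLaplacian_apply, h0] at h
    simpa using h
  funext v
  rw [P.eq_of_laplacian_mulVec_eq_zero h1 v P.slack, h0, Pi.zero_apply]

/-- The voltage angles that realize a balanced vector of bus injections. -/
noncomputable def angle (P : PowerNetwork nG nL nE) : (Bus nG nL → ℝ) →ₗ[ℝ] (Bus nG nL → ℝ) :=
  (LinearEquiv.ofInjectiveEndo P.groundedLaplacian P.groundedLaplacian_injective).symm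

theorem groundedLaplacian_angle (P : PowerNetwork nG nL nE) (r : Bus nG nL → ℝ) :
    P.groundedLaplacian (P.angle r) = r :=
  (LinearEquiv.ofInjectiveEndo P.groundedLaplacian
    P.groundedLaplacian_injective).apply_symm_apply r

theorem angle_slack (P : PowerNetwork nG nL nE) (r : Bus nG nL → ℝ) :
    P.angle r P.slack = ∑ v, r v := by
  rw [← P.sum_groundedLaplacian (P.angle r), groundedLaplacian_angle]

theorem laplacian_mulVec_angle (P : PowerNetwork nG nL nE) {r : Bus nG nL → ℝ}
    (h : ∑ v, r v = 0) : P.laplacian *ᵥ P.angle r = r := by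
  have := P.groundedLaplacian_angle r
  rwa [groundedLaplacian_apply, angle_slack, h, Pi.single_zero, add_zero] at this

theorem angle_laplacian_mulVec (P : PowerNetwork nG nL nE) {θ : Bus nG nL → ℝ}
    (h : θ P.slack = 0) : P.angle (P.laplacian *ᵥ θ) = θ := by
  apply P.groundedLaplacian_injective
  rw [groundedLaplacian_angle, groundedLaplacian_apply, h, Pi.single_zero, add_zero]

theorem continuous_angle (P : PowerNetwork nG nL nE) : Continuous P.angle :=
  LinearMap.continuous_of_finiteDimensional _

theorem Feasible.angle_eq {P : PowerNetwork nG nL nE} {ξ : SystemLimits nG nE}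
    {sl : Fin nL → ℝ} {sg : Fin nG → ℝ} {θ : Bus nG nL → ℝ} (h : P.Feasible ξ sl sg θ) :
    θ = P.angle (Sum.elim sg (fun j => - sl j)) := by
  rw [← h.balance, P.angle_laplacian_mulVec h.slack_angle]

/-- Small perturbations that respect the binding constraints preserve feasibility. -/
theorem Feasible.eventually_add {P : PowerNetwork nG nL nE} {ξ : SystemLimits nG nE}
    {sl : Fin nL → ℝ} {sg : Fin nG → ℝ} {θ : Bus nG nL → ℝ} (h : P.Feasible ξ sl sg θ)
    {ι : Type*} {l : Filter ι} {δ : ι → Fin nL → ℝ} {d : ι → Fin nG → ℝ}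
    {η : ι → Bus nG nL → ℝ} (hd : Tendsto d l (𝓝 0)) (hη : Tendsto η l (𝓝 0))
    (hs : ∀ w, η w P.slack = 0)
    (hL : ∀ w, P.laplacian *ᵥ η w = Sum.elim (d w) (fun j => - δ w j))
    (hgl : ∀ i, sg i = ξ.sgMin i → ∀ᶠ w in l, 0 ≤ d w i)
    (hgu : ∀ i, sg i = ξ.sgMax i → ∀ᶠ w in l, d w i ≤ 0)
    (hpl : ∀ e, P.flow θ e = ξ.pMin e → ∀ᶠ w in l, 0 ≤ P.flow (η w) e)
    (hpu : ∀ e, P.flow θ e = ξ.pMax e → ∀ᶠ w in l, P.flow (η w) e ≤ 0) :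
    ∀ᶠ w in l, P.Feasible ξ (sl + δ w) (sg + d w) (θ + η w) := by
  -- A binding limit is kept by the sign of the perturbation, a slack one by its smallness.
  have low : ∀ {a c : ℝ} {u : ι → ℝ}, c ≤ a → Tendsto u l (𝓝 0) →
      (a = c → ∀ᶠ w in l, 0 ≤ u w) → ∀ᶠ w in l, c ≤ a + u w := by
    intro a c u hca hu hb
    rcases hca.eq_or_lt with he | hlt
    · filter_upwards [hb he.symm] with w hw
      linarith
    · filter_upwards [hu.eventually (lt_mem_nhds (sub_neg.2 hlt))] with w hw
      linarith
  have upp : ∀ {a c : ℝ} {u : ι → ℝ}, a ≤ c → Tendsto u l (𝓝 0) →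
      (a = c → ∀ᶠ w in l, u w ≤ 0) → ∀ᶠ w in l, a + u w ≤ c := by
    intro a c u hca hu hb
    rcases hca.eq_or_lt with he | hlt
    · filter_upwards [hb he] with w hw
      linarith
    · filter_upwards [hu.eventually (gt_mem_nhds (sub_pos.2 hlt))] with w hw
      linarith
  have hd' : ∀ i, Tendsto (fun w => d w i) l (𝓝 0) := fun i => (tendsto_pi_nhds.1 hd) i
  have hf' : ∀ e, Tendsto (fun w => P.flow (η w) e) l (𝓝 0) := fun e => by
    have h0 : P.flow 0 = 0 := Matrix.mulVec_zero _
    have := (P.continuous_flow.tendsto 0).comp hη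
    rw [h0] at this
    exact (tendsto_pi_nhds.1 this) e
  filter_upwards [eventually_all.2 fun i => low (h.gen_lower i) (hd' i) (hgl i),
    eventually_all.2 fun i => upp (h.gen_upper i) (hd' i) (hgu i),
    eventually_all.2 fun e => low (h.flow_lower e) (hf' e) (hpl e),
    eventually_all.2 fun e => upp (h.flow_upper e) (hf' e) (hpu e)] with w h1 h2 h3 h4
  refine ⟨?_, ?_, h1, h2, ?_, ?_⟩
  · rw [Pi.add_apply, h.slack_angle, hs, add_zero]
  · rw [Matrix.mulVec_add, h.balance, hL]
    funext v
    rcases v with i | j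
    · rfl
    · simp only [Pi.add_apply, Sum.elim_inr]
      ring
  · rw [flow_add]; exact h3
  · rw [flow_add]; exact h4

theorem Feasible.convex_comb {P : PowerNetwork nG nL nE} {ξ : SystemLimits nG nE}
    {s₁ s₂ : Fin nL → ℝ} {g₁ g₂ : Fin nG → ℝ} {θ₁ θ₂ : Bus nG nL → ℝ}
    (h₁ : P.Feasible ξ s₁ g₁ θ₁) (h₂ : P.Feasible ξ s₂ g₂ θ₂) {a b : ℝ} (ha : 0 ≤ a)
    (hb : 0 ≤ b) (hab : a + b = 1) :
    P.Feasible ξ (a • s₁ + b • s₂) (a • g₁ + b • g₂) (a • θ₁ + b • θ₂) := by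
  refine ⟨?_, ?_, ?_, ?_, ?_, ?_⟩
  · simp [h₁.slack_angle, h₂.slack_angle]
  · rw [Matrix.mulVec_add, Matrix.mulVec_smul, Matrix.mulVec_smul, h₁.balance, h₂.balance]
    funext v
    rcases v with i | j
    · rfl
    · simp only [Pi.add_apply, Pi.smul_apply, smul_eq_mul, Sum.elim_inr]
      ring
  · exact convex_Ici ξ.sgMin h₁.gen_lower h₂.gen_lower ha hb hab
  · exact convex_Iic ξ.sgMax h₁.gen_upper h₂.gen_upper ha hb hab
  · rw [flow_add, flow_smul, flow_smul]
    exact convex_Ici ξ.pMin h₁.flow_lower h₂.flow_lower ha hb hab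
  · rw [flow_add, flow_smul, flow_smul]
    exact convex_Iic ξ.pMax h₁.flow_upper h₂.flow_upper ha hb hab

end PowerNetwork

/-! ### Bridges, descending paths and the sign of a transfer -/

namespace PowerNetwork

section

variable {nG nL nE : ℕ}

/-- The buses connected to the source of `e` after deletion of `e`. -/
def sourceSide (P : PowerNetwork nG nL nE) (e : Fin nE) : Set (Bus nG nL) :=
  {v | (P.graph.deleteEdges {(P.edge e : Sym2 (Bus nG nL))}).Reachable (P.src e) v}

theorem src_mem_sourceSide (P : PowerNetwork nG nL nE) (e : Fin nE) :
    P.src e ∈ P.sourceSide e := SimpleGraph.Reachable.refl _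

theorem dst_notMem_sourceSide {P : PowerNetwork nG nL nE} {e : Fin nE} (he : e ∈ P.bridges) :
    P.dst e ∉ P.sourceSide e := by
  intro h
  refine he ?_
  unfold sourceSide at h
  rw [Set.mem_ofPred_eq] at h
  rw [P.edge_eq] at h ⊢
  exact P.connected.connected_delete_edge_of_not_isBridge fun hb =>
    SimpleGraph.isBridge_iff.1 hb h

/-- Only `e` itself leaves the source side of `e`. -/
theorem mem_sourceSide_iff_of_adj {P : PowerNetwork nG nL nE} {e : Fin nE} {v w : Bus nG nL}
    (h : P.graph.Adj v w) (hne : s(P.src e, P.dst e) ≠ s(v, w)) :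
    v ∈ P.sourceSide e ↔ w ∈ P.sourceSide e := by
  have hadj : (P.graph.deleteEdges {(P.edge e : Sym2 (Bus nG nL))}).Adj v w := by
    rw [SimpleGraph.deleteEdges_adj, P.edge_eq]
    exact ⟨h, fun h' => hne (Set.mem_singleton_iff.1 h').symm⟩
  exact ⟨fun hv => hv.trans hadj.reachable, fun hw => hw.trans hadj.symm.reachable⟩

open Classical in
/-- The flow on a bridge is the net injection on its source side. -/
theorem flow_eq_sum_sourceSide {P : PowerNetwork nG nL nE} {e : Fin nE} (he : e ∈ P.bridges)
    (θ : Bus nG nL → ℝ) :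
    P.flow θ e = ∑ v ∈ Finset.univ.filter (· ∈ P.sourceSide e), (P.laplacian *ᵥ θ) v := by
  rw [sum_laplacian_mulVec, Finset.sum_eq_single e]
  · simp [src_mem_sourceSide, dst_notMem_sourceSide he]
  · intro e' _ hne
    have hiff := mem_sourceSide_iff_of_adj (e := e) (P.adj_src_dst e') (by
      rw [← P.edge_eq, ← P.edge_eq]
      exact fun h => hne (P.edge.injective (Subtype.ext h)).symm)
    simp [hiff]
  · simp

/-- A descending step of the angles `θ` along an edge, that is, one of positive flow. -/
def DownStep (P : PowerNetwork nG nL nE) (θ : Bus nG nL → ℝ) (v w : Bus nG nL) : Prop :=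
  P.graph.Adj v w ∧ θ w < θ v

/-- A bus of negative injection is fed by a generator of positive injection, if all loads have
nonpositive injection. -/
theorem exists_pos_of_neg (P : PowerNetwork nG nL nE) {θ : Bus nG nL → ℝ}
    (hload : ∀ j, (P.laplacian *ᵥ θ) (Sum.inr j) ≤ 0) {v : Bus nG nL}
    (hv : (P.laplacian *ᵥ θ) v < 0) :
    ∃ k, 0 < (P.laplacian *ᵥ θ) (Sum.inl k) ∧
      Relation.ReflTransGen (P.DownStep θ) (Sum.inl k) v := by
  classical
  by_contra! hcon
  -- `S` contains `v`, and by `hcon` no bus of positive injection, so its net injection is negative.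
  -- But positive flow cannot enter `S`: its tail would also reach `v` by descending steps.
  set S : Finset (Bus nG nL) :=
    Finset.univ.filter fun w => Relation.ReflTransGen (P.DownStep θ) w v with hS
  have hmem : ∀ w, w ∈ S ↔ Relation.ReflTransGen (P.DownStep θ) w v := by simp [hS]
  have hneg : ∑ w ∈ S, (P.laplacian *ᵥ θ) w < 0 := by
    refine Finset.sum_neg' (fun w hw => ?_) ⟨v, (hmem v).2 .refl, hv⟩
    rcases w with k | j
    · by_contra! hk
      exact hcon k hk ((hmem _).1 hw)
    · exact hload j
  refine hneg.not_ge ?_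
  rw [sum_laplacian_mulVec]
  refine Finset.sum_nonneg fun e _ => ?_
  rw [flow_apply]
  have hb := P.b_pos e
  have key : ∀ {x y}, P.graph.Adj x y → x ∉ S → y ∈ S → θ x ≤ θ y := by
    intro x y hxy hx hy
    by_contra! hlt
    exact hx ((hmem x).2 (.head ⟨hxy, hlt⟩ ((hmem y).1 hy)))
  by_cases h1 : P.src e ∈ S <;> by_cases h2 : P.dst e ∈ S <;>
    simp only [h1, h2, if_true, if_false, sub_self, zero_mul, le_refl, sub_zero, one_mul, zero_sub]
  · exact mul_nonneg hb.le (sub_nonneg.2 (key (P.adj_src_dst e).symm h2 h1))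
  · have := mul_nonneg hb.le (sub_nonneg.2 (key (P.adj_src_dst e) h1 h2))
    linarith

theorem exists_step_of_mem_of_notMem {α : Type*} {r : α → α → Prop} {T : Set α} {x y : α}
    (h : Relation.ReflTransGen r x y) (hx : x ∈ T) (hy : y ∉ T) :
    ∃ a ∈ T, ∃ b ∉ T, r a b := by
  induction h with
  | refl => exact absurd hx hy
  | @tail b c _ hbc ih =>
    by_cases hb : b ∈ T
    · exact ⟨b, hb, c, hy, hbc⟩
    · exact ih hb

/-- The path must leave the source side somewhere, and the only edge available is `e`, traversed
from source to target. -/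
theorem flow_pos_of_downPath {P : PowerNetwork nG nL nE} {e : Fin nE}
    (he : e ∈ P.bridges) {θ : Bus nG nL → ℝ} {v w : Bus nG nL}
    (h : Relation.ReflTransGen (P.DownStep θ) v w)
    (hv : v ∈ P.sourceSide e) (hw : w ∉ P.sourceSide e) : 0 < P.flow θ e := by
  obtain ⟨a, ha, b, hb, hab, hlt⟩ := exists_step_of_mem_of_notMem h hv hw
  have heq : s(P.src e, P.dst e) = s(a, b) := by
    by_contra hne
    exact hb ((mem_sourceSide_iff_of_adj hab hne).1 ha)
  rw [flow_apply]
  rcases Sym2.eq_iff.1 heq with ⟨rfl, rfl⟩ | ⟨rfl, rfl⟩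
  · exact mul_pos (P.b_pos e) (sub_pos.2 hlt)
  · exact absurd ha (dst_notMem_sourceSide he)

theorem flow_neg_of_downPath {P : PowerNetwork nG nL nE} {e : Fin nE}
    {θ : Bus nG nL → ℝ} {v w : Bus nG nL}
    (h : Relation.ReflTransGen (P.DownStep θ) v w)
    (hv : v ∉ P.sourceSide e) (hw : w ∈ P.sourceSide e) : P.flow θ e < 0 := by
  obtain ⟨a, ha, b, hb, hab, hlt⟩ :=
    exists_step_of_mem_of_notMem (T := (P.sourceSide e)ᶜ) h hv (not_not_intro hw)
  rw [Set.mem_compl_iff, not_not] at hb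
  have heq : s(P.src e, P.dst e) = s(a, b) := by
    by_contra hne
    exact ha ((mem_sourceSide_iff_of_adj hab hne).2 hb)
  rw [flow_apply]
  rcases Sym2.eq_iff.1 heq with ⟨rfl, rfl⟩ | ⟨rfl, rfl⟩
  · exact absurd (P.src_mem_sourceSide e) ha
  · exact mul_neg_of_pos_of_neg (P.b_pos e) (sub_neg.2 hlt)

/-- Along a bridge, a transfer from `w` to `v` runs against the flow if there is a descending
path from `v` to `w`. -/
theorem transfer_opposes_flow {P : PowerNetwork nG nL nE} {e : Fin nE}
    (he : e ∈ P.bridges) {θ η : Bus nG nL → ℝ} {v w : Bus nG nL}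
    (h : Relation.ReflTransGen (P.DownStep θ) v w)
    (hη : P.laplacian *ᵥ η = Pi.single w 1 - Pi.single v 1) :
    (0 < P.flow η e → P.flow θ e < 0) ∧ (P.flow η e < 0 → 0 < P.flow θ e) := by
  classical
  -- A bridge carries either the whole unit of the transfer or none of it.
  have hflow : P.flow η e =
      (if w ∈ P.sourceSide e then 1 else 0) - (if v ∈ P.sourceSide e then 1 else 0) := by
    rw [flow_eq_sum_sourceSide he, hη]
    simp only [Pi.sub_apply, Finset.sum_sub_distrib, Finset.sum_pi_single', Finset.mem_filter,
      Finset.mem_univ, true_and]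
  by_cases hv : v ∈ P.sourceSide e <;> by_cases hw : w ∈ P.sourceSide e
  · simp [hflow, hv, hw]
  · exact ⟨fun h1 => by norm_num [hflow, hv, hw] at h1, fun _ => flow_pos_of_downPath he h hv hw⟩
  · exact ⟨fun _ => flow_neg_of_downPath h hv hw, fun h1 => by norm_num [hflow, hv, hw] at h1⟩
  · simp [hflow, hv, hw]

end

/-! ### The exchange argument -/

variable {nG nL nE : ℕ} [NeZero nG] {P : PowerNetwork nG nL nE} {ξ : SystemLimits nG nE}
  {f : Fin nG → ℝ}

theorem IsOptimal.eq_of_isOptimal (hf : f ∈ P.costSet ξ) {sl : Fin nL → ℝ}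
    (hsl : sl ∈ P.loadSet ξ) {g₁ g₂ : Fin nG → ℝ} {θ₁ θ₂ : Bus nG nL → ℝ}
    (h₁ : P.IsOptimal ξ f sl g₁ θ₁) (h₂ : P.IsOptimal ξ f sl g₂ θ₂) : g₁ = g₂ ∧ θ₁ = θ₂ := by
  have := (hf sl hsl).1.unique (y₁ := (g₁, θ₁)) (y₂ := (g₂, θ₂)) h₁ h₂
  exact Prod.ext_iff.1 this

/-- A direction of the decision variables that respects the binding constraints is feasible. -/
theorem Feasible.exists_step {sl : Fin nL → ℝ} {sg : Fin nG → ℝ} {θ : Bus nG nL → ℝ}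
    (h : P.Feasible ξ sl sg θ) {d : Fin nG → ℝ} {η : Bus nG nL → ℝ}
    (hs : η P.slack = 0) (hL : P.laplacian *ᵥ η = Sum.elim d 0)
    (hgl : ∀ i, sg i = ξ.sgMin i → 0 ≤ d i) (hgu : ∀ i, sg i = ξ.sgMax i → d i ≤ 0)
    (hpl : ∀ e, P.flow θ e = ξ.pMin e → 0 ≤ P.flow η e)
    (hpu : ∀ e, P.flow θ e = ξ.pMax e → P.flow η e ≤ 0) :
    ∃ ε : ℝ, 0 < ε ∧ P.Feasible ξ sl (sg + ε • d) (θ + ε • η) := by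
  have ht : ∀ {V : Type} [AddCommGroup V] [Module ℝ V] [TopologicalSpace V]
      [ContinuousSMul ℝ V] (x : V), Tendsto (fun ε : ℝ => ε • x) (𝓝[>] 0) (𝓝 0) := by
    intro V _ _ _ _ x
    have hc : Continuous fun ε : ℝ => ε • x := continuous_id.smul continuous_const
    have := hc.tendsto 0
    rw [zero_smul] at this
    exact this.mono_left nhdsWithin_le_nhds
  have hpos : ∀ᶠ ε : ℝ in 𝓝[>] 0, 0 < ε := eventually_mem_nhdsWithin
  have hev := h.eventually_add (l := 𝓝[>] (0 : ℝ)) (δ := fun _ => 0) (d := fun ε => ε • d)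
    (η := fun ε => ε • η) (ht d) (ht η) (fun ε => by simp [hs])
    (fun ε => by
      rw [Matrix.mulVec_smul, hL]
      funext v
      rcases v with i | j <;> simp)
    (fun i hi => hpos.mono fun ε hε => mul_nonneg hε.le (hgl i hi))
    (fun i hi => hpos.mono fun ε hε => mul_nonpos_of_nonneg_of_nonpos hε.le (hgu i hi))
    (fun e he => hpos.mono fun ε hε => by
      rw [flow_smul]; exact mul_nonneg hε.le (hpl e he))
    (fun e he => hpos.mono fun ε hε => by
      rw [flow_smul]; exact mul_nonpos_of_nonneg_of_nonpos hε.le (hpu e he))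
  obtain ⟨ε, hε, h0⟩ := (hev.and hpos).exists
  exact ⟨ε, h0, by simpa using hε⟩

theorem IsOptimal.nonneg_of_step {sl : Fin nL → ℝ} {sg : Fin nG → ℝ} {θ θ' : Bus nG nL → ℝ}
    (h : P.IsOptimal ξ f sl sg θ) {d : Fin nG → ℝ} {ε : ℝ} (hε : 0 < ε)
    (hfeas : P.Feasible ξ sl (sg + ε • d) θ') : 0 ≤ f ⬝ᵥ d := by
  have := h.2 _ _ hfeas
  rw [dotProduct_add, dotProduct_smul, smul_eq_mul] at this
  exact nonneg_of_mul_nonneg_right (by linarith) hε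

/-- If moving in direction `d` is feasible and costs nothing, then `d = 0`. -/
theorem IsOptimal.step_eq_zero (hf : f ∈ P.costSet ξ) {sl : Fin nL → ℝ}
    (hsl : sl ∈ P.loadSet ξ) {sg : Fin nG → ℝ} {θ θ' : Bus nG nL → ℝ}
    (h : P.IsOptimal ξ f sl sg θ) {d : Fin nG → ℝ} {ε : ℝ} (hε : 0 < ε)
    (hfeas : P.Feasible ξ sl (sg + ε • d) θ') (hd : f ⬝ᵥ d ≤ 0) : d = 0 := by
  have hopt : P.IsOptimal ξ f sl (sg + ε • d) θ' := by
    refine ⟨hfeas, fun sg' θ'' h' => le_trans ?_ (h.2 sg' θ'' h')⟩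
    rw [dotProduct_add, dotProduct_smul, smul_eq_mul]
    have := mul_nonpos_of_nonneg_of_nonpos hε.le hd
    linarith
  have := (IsOptimal.eq_of_isOptimal hf hsl h hopt).1
  exact (smul_eq_zero.1 (left_eq_add.1 this)).resolve_left hε.ne'

/-- Monotonicity for loads at whose optimal solutions only bridges bind. -/
theorem IsOptimal.le_of_bridges (hf : f ∈ P.costSet ξ) {α β : Fin nL → ℝ}
    (hα : α ∈ P.loadSet ξ) (hβα : β ≤ α)
    {a b : Fin nG → ℝ} {θa θb : Bus nG nL → ℝ}
    (ha : P.IsOptimal ξ f α a θa) (hb : P.IsOptimal ξ f β b θb)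
    (hbra : P.bindingBranches ξ θa ⊆ P.bridges) (hbrb : P.bindingBranches ξ θb ⊆ P.bridges) :
    b ≤ a := by
  by_contra hnle
  obtain ⟨i, hi⟩ : ∃ i, a i < b i := by simpa [Pi.le_def] using hnle
  have hΔ : P.laplacian *ᵥ (θa - θb) = Sum.elim (a - b) (fun j => β j - α j) := by
    rw [Matrix.mulVec_sub, ha.1.balance, hb.1.balance]
    funext v
    rcases v with k | j
    · rfl
    · simp only [Pi.sub_apply, Sum.elim_inr]
      ring
  obtain ⟨k, hk, hpath⟩ := P.exists_pos_of_neg (θ := θa - θb) (v := Sum.inl i)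
    (fun j => by rw [hΔ]; exact sub_nonpos.2 (hβα j))
    (by rw [hΔ]; exact sub_neg.2 hi)
  rw [hΔ] at hk
  have hk' : b k < a k := sub_pos.1 hk
  have hik : i ≠ k := by
    rintro rfl
    exact lt_asymm hi hk'
  -- The transfer of one unit of generation from `k` to `i`, with `η` below the angles realizing it.
  set d : Fin nG → ℝ := Pi.single i 1 - Pi.single k 1 with hd
  set r : Bus nG nL → ℝ := Pi.single (Sum.inl i) 1 - Pi.single (Sum.inl k) 1 with hr
  have hrd : r = Sum.elim d 0 := by
    funext v
    rcases v with m | j <;> simp [hr, hd, Pi.single_apply]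
  have hsum : ∑ v, r v = 0 := by
    simp only [hr, Pi.sub_apply, Finset.sum_sub_distrib, Finset.sum_pi_single', Finset.mem_univ,
      if_true, sub_self]
  set η := P.angle r
  have hηs : η P.slack = 0 := (P.angle_slack r).trans hsum
  have hηL : P.laplacian *ᵥ η = r := P.laplacian_mulVec_angle hsum
  have hdi : ∀ m, 0 < d m → m = i := by
    intro m hm
    by_contra hne
    simp only [hd, Pi.sub_apply, Pi.single_apply, if_neg hne] at hm
    split_ifs at hm <;> norm_num at hm
  have hdk : ∀ m, d m < 0 → m = k := by
    intro m hm
    by_contra hne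
    simp only [hd, Pi.sub_apply, Pi.single_apply, if_neg hne] at hm
    split_ifs at hm <;> norm_num at hm
  have hopp : ∀ e ∈ P.bridges, (0 < P.flow η e → P.flow θa e < P.flow θb e) ∧
      (P.flow η e < 0 → P.flow θb e < P.flow θa e) := by
    intro e he
    have := transfer_opposes_flow he hpath hηL
    rw [flow_sub, Pi.sub_apply, sub_neg, sub_pos] at this
    exact this
  -- At `a`, a limit that is binding and violated by the transfer would have to be violated by `b`
  -- already.
  obtain ⟨ε, hε, hfa⟩ := ha.1.exists_step hηs (hηL.trans hrd)
    (fun m hm => by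
      by_contra! hlt
      obtain rfl := hdk m hlt
      exact (hb.1.gen_lower m).not_gt (hm ▸ hk'))
    (fun m hm => by
      by_contra! hlt
      obtain rfl := hdi m hlt
      exact (hb.1.gen_upper m).not_gt (hm ▸ hi))
    (fun e he => by
      by_contra! hlt
      exact (hb.1.flow_lower e).not_gt (he ▸ (hopp e (hbra (Or.inl he))).2 hlt))
    (fun e he => by
      by_contra! hlt
      exact (hb.1.flow_upper e).not_gt (he ▸ (hopp e (hbra (Or.inr he))).1 hlt))
  -- The reverse transfer at `b`, with the roles of `a` and `b` exchanged.
  obtain ⟨ε', hε', hfb⟩ := hb.1.exists_step (d := -d) (η := -η) (by simp [hηs])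
    (by
      rw [Matrix.mulVec_neg, hηL, hrd]
      funext v
      rcases v with m | j <;> simp)
    (fun m hm => by
      by_contra! hlt
      obtain rfl := hdi m (neg_neg_iff_pos.1 hlt)
      exact (ha.1.gen_lower m).not_gt (hm ▸ hi))
    (fun m hm => by
      by_contra! hlt
      obtain rfl := hdk m (neg_pos.1 hlt)
      exact (ha.1.gen_upper m).not_gt (hm ▸ hk'))
    (fun e he => by
      by_contra! hlt
      rw [← neg_one_smul ℝ η, flow_smul, neg_one_smul, Pi.neg_apply, neg_neg_iff_pos] at hlt
      exact (ha.1.flow_lower e).not_gt (he ▸ (hopp e (hbrb (Or.inl he))).1 hlt))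
    (fun e he => by
      by_contra! hlt
      rw [← neg_one_smul ℝ η, flow_smul, neg_one_smul, Pi.neg_apply, neg_pos] at hlt
      exact (ha.1.flow_upper e).not_gt (he ▸ (hopp e (hbrb (Or.inr he))).2 hlt))
  have hcost := hb.nonneg_of_step hε' hfb
  rw [dotProduct_neg] at hcost
  have hd0 := ha.step_eq_zero hf hα hε hfa (by linarith)
  have : d i = 1 := by simp [hd, hik]
  rw [hd0] at this
  exact zero_ne_one this

end PowerNetwork

/-! ### Regular loads are interior -/

namespace PowerNetwork

variable {nG nL nE : ℕ}

/-- Generations as bus injections. -/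
def genInjection : (Fin nG → ℝ) →ₗ[ℝ] (Bus nG nL → ℝ) where
  toFun d := Sum.elim d 0
  map_add' x y := by funext v; rcases v with i | j <;> simp
  map_smul' c x := by funext v; rcases v with i | j <;> simp

/-- Loads as bus injections. -/
def loadInjection : (Fin nL → ℝ) →ₗ[ℝ] (Bus nG nL → ℝ) where
  toFun δ := Sum.elim 0 (fun j => - δ j)
  map_add' x y := by funext v; rcases v with i | j <;> simp [add_comm]
  map_smul' c x := by funext v; rcases v with i | j <;> simp

theorem genInjection_add_loadInjection (d : Fin nG → ℝ) (δ : Fin nL → ℝ) :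
    genInjection d + loadInjection δ = (Sum.elim d (fun j => - δ j) : Bus nG nL → ℝ) := by
  funext v
  rcases v with i | j <;> simp [genInjection, loadInjection]

/-- The branch flows as a linear function of the injections. -/
noncomputable def flowOfInjection (P : PowerNetwork nG nL nE) [NeZero nG] :
    (Bus nG nL → ℝ) →ₗ[ℝ] (Fin nE → ℝ) :=
  (Matrix.diagonal P.b * P.incidenceᵀ).mulVecLin.comp P.angle

variable [NeZero nG] {P : PowerNetwork nG nL nE} {ξ : SystemLimits nG nE} {f : Fin nG → ℝ}

theorem flowOfInjection_apply (P : PowerNetwork nG nL nE) (r : Bus nG nL → ℝ) :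
    P.flowOfInjection r = P.flow (P.angle r) := rfl

/-- The total generation, with the entries of generations and flows on given generators and
branches. -/
noncomputable def bindingMap (P : PowerNetwork nG nL nE) (A : Set (Fin nG)) (F : Set (Fin nE)) :
    (Fin nG → ℝ) →ₗ[ℝ] ℝ × (A → ℝ) × (F → ℝ) :=
  (∑ i, LinearMap.proj i).prod ((LinearMap.funLeft ℝ ℝ (↑)).prod
    ((LinearMap.funLeft ℝ ℝ (↑)).comp (P.flowOfInjection.comp genInjection)))

theorem bindingMap_apply (P : PowerNetwork nG nL nE) (A : Set (Fin nG)) (F : Set (Fin nE))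
    (d : Fin nG → ℝ) :
    P.bindingMap A F d = (∑ i, d i, fun i : A => d i,
      fun e : F => P.flowOfInjection (genInjection d) e) :=
  Prod.ext (LinearMap.sum_apply _ _ _) rfl

/-- Along a kernel direction `d` all binding quantities and the balance stay fixed, so small steps
along both `d` and `-d` are feasible. Optimality then gives cost zero, and uniqueness gives `d = 0`.
-/
theorem IsOptimal.bindingMap_injective (hf : f ∈ P.costSet ξ) {sl : Fin nL → ℝ}
    (hsl : sl ∈ P.loadSet ξ) {sg : Fin nG → ℝ} {θ : Bus nG nL → ℝ}
    (h : P.IsOptimal ξ f sl sg θ) :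
    Function.Injective (P.bindingMap (bindingGens ξ sg) (P.bindingBranches ξ θ)) := by
  rw [injective_iff_map_eq_zero]
  intro d hd
  rw [bindingMap_apply, Prod.mk_eq_zero, Prod.mk_eq_zero] at hd
  obtain ⟨hsum, hA, hF⟩ := hd
  have hA' : ∀ i ∈ bindingGens ξ sg, d i = 0 := fun i hi => congrFun hA ⟨i, hi⟩
  have hF' : ∀ e ∈ P.bindingBranches ξ θ, P.flow (P.angle (genInjection d)) e = 0 :=
    fun e he => congrFun hF ⟨e, he⟩
  have hsum' : ∑ v, (genInjection d : Bus nG nL → ℝ) v = 0 := by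
    simp [genInjection, hsum]
  have hs := (P.angle_slack _).trans hsum'
  have hL := P.laplacian_mulVec_angle hsum'
  obtain ⟨ε, hε, h1⟩ := h.1.exists_step hs hL (fun i hi => (hA' i (Or.inl hi)).ge)
    (fun i hi => (hA' i (Or.inr hi)).le) (fun e he => (hF' e (Or.inl he)).ge)
    (fun e he => (hF' e (Or.inr he)).le)
  have hneg : ∀ e, P.flow (-P.angle (genInjection d)) e =
      -P.flow (P.angle (genInjection d)) e := fun e => by
    rw [← neg_one_smul ℝ (P.angle _), flow_smul, neg_one_smul, Pi.neg_apply]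
  obtain ⟨ε', hε', h2⟩ := h.1.exists_step (d := -d) (η := -P.angle (genInjection d))
    (by rw [Pi.neg_apply, hs, neg_zero])
    (by
      rw [Matrix.mulVec_neg, hL]
      funext v
      rcases v with i | j <;> simp [genInjection])
    (fun i hi => by rw [Pi.neg_apply, hA' i (Or.inl hi), neg_zero])
    (fun i hi => by rw [Pi.neg_apply, hA' i (Or.inr hi), neg_zero])
    (fun e he => by rw [hneg, hF' e (Or.inl he), neg_zero])
    (fun e he => by rw [hneg, hF' e (Or.inr he), neg_zero])
  have hcost := h.nonneg_of_step hε' h2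
  rw [dotProduct_neg] at hcost
  exact h.step_eq_zero hf hsl hε h1 (by linarith)

/-- Regular loads are interior: the binding constraints can be kept when the load changes. -/
theorem loadSet_mem_nhds (hf : f ∈ P.costSet ξ) {sl : Fin nL → ℝ}
    (hsl : sl ∈ P.regularLoadSet ξ f) : P.loadSet ξ ∈ 𝓝 sl := by
  classical
  obtain ⟨hmem, sg, θ, hopt, hcard⟩ := hsl
  set A := bindingGens ξ sg with hA
  set F := P.bindingBranches ξ θ with hF
  have hinj : Function.Injective (P.bindingMap A F) := hopt.bindingMap_injective hf hmem
  -- Regularity makes the system square: the `nG - 1` binding constraints and the total balance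
  -- against `nG` generations.
  have hrank : Module.finrank ℝ (Fin nG → ℝ) = Module.finrank ℝ (ℝ × (A → ℝ) × (F → ℝ)) := by
    rw [Module.finrank_prod, Module.finrank_prod, Module.finrank_self, Module.finrank_pi,
      Module.finrank_pi, Module.finrank_pi, Fintype.card_fin, ← Nat.card_eq_fintype_card,
      ← Nat.card_eq_fintype_card, Nat.card_coe_set_eq, Nat.card_coe_set_eq]
    omega
  have hsurj := (LinearMap.injective_iff_surjective_of_finrank_eq_finrank hrank).1 hinj
  obtain ⟨R, hR⟩ := (P.bindingMap A F).exists_rightInverse_of_surjective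
    (LinearMap.range_eq_top.2 hsurj)
  -- The response demanded of the generators to a load change: match its total, leave generators at
  -- their limits alone, and cancel its effect on the binding flows.
  let Ψ : (Fin nL → ℝ) →ₗ[ℝ] ℝ × (A → ℝ) × (F → ℝ) :=
    (∑ j, LinearMap.proj j).prod ((0 : (Fin nL → ℝ) →ₗ[ℝ] (A → ℝ)).prod
      (-((LinearMap.funLeft ℝ ℝ (↑)).comp (P.flowOfInjection.comp loadInjection))))
  have hΨ : ∀ δ, Ψ δ = (∑ j, δ j, 0,
      fun e : F => -P.flowOfInjection (loadInjection δ) e) :=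
    fun δ => Prod.ext (LinearMap.sum_apply _ _ _) rfl
  let D := R.comp Ψ
  have hD : ∀ δ, P.bindingMap A F (D δ) = Ψ δ := fun δ => LinearMap.congr_fun hR (Ψ δ)
  simp only [bindingMap_apply, hΨ, Prod.mk.injEq] at hD
  let r : (Fin nL → ℝ) →ₗ[ℝ] (Bus nG nL → ℝ) := genInjection.comp D + loadInjection
  have hr : ∀ δ, r δ = Sum.elim (D δ) (fun j => - δ j) := fun δ =>
    genInjection_add_loadInjection _ _
  have hsum : ∀ δ, ∑ v, r δ v = 0 := by
    intro δ
    simp [hr, (hD δ).1]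
  have hDA : ∀ δ, ∀ i ∈ A, D δ i = 0 := fun δ i hi => congrFun (hD δ).2.1 ⟨i, hi⟩
  have hDF : ∀ δ, ∀ e ∈ F, P.flow (P.angle (r δ)) e = 0 := by
    intro δ e he
    have h1 : P.flowOfInjection (genInjection (D δ)) e =
        -P.flowOfInjection (loadInjection δ) e := congrFun (hD δ).2.2 ⟨e, he⟩
    have h2 : r δ = genInjection (D δ) + loadInjection δ := rfl
    rw [← flowOfInjection_apply, h2, map_add, Pi.add_apply, h1, neg_add_cancel]
  have tends : ∀ {m : Type} [Fintype m] (T : (Fin nL → ℝ) →ₗ[ℝ] (m → ℝ)),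
      Tendsto T (𝓝 0) (𝓝 0) := by
    intro m _ T
    have := T.continuous_of_finiteDimensional.tendsto 0
    rwa [map_zero] at this
  have hfeas := hopt.1.eventually_add (l := 𝓝 (0 : Fin nL → ℝ)) (δ := fun δ => δ)
    (d := D) (η := fun δ => P.angle (r δ)) (tends D) (tends (P.angle.comp r))
    (fun δ => (P.angle_slack _).trans (hsum δ))
    (fun δ => (P.laplacian_mulVec_angle (hsum δ)).trans (hr δ))
    (fun i hi => .of_forall fun δ => (hDA δ i (Or.inl hi)).ge)
    (fun i hi => .of_forall fun δ => (hDA δ i (Or.inr hi)).le)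
    (fun e he => .of_forall fun δ => (hDF δ e (Or.inl he)).ge)
    (fun e he => .of_forall fun δ => (hDF δ e (Or.inr he)).le)
  have hpos : ∀ᶠ s in 𝓝 sl, ∀ j, 0 < s j :=
    eventually_all.2 fun j => (continuous_apply j).tendsto sl |>.eventually
      (lt_mem_nhds (hmem.1 j))
  have hshift : Tendsto (fun s => s - sl) (𝓝 sl) (𝓝 0) := by
    have h0 : Continuous fun s : Fin nL → ℝ => s - sl := continuous_id.sub continuous_const
    have := h0.tendsto sl
    rwa [sub_self] at this
  filter_upwards [hpos, hshift.eventually hfeas] with s h1 h2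
  rw [add_sub_cancel] at h2
  exact ⟨h1, _, _, h2⟩

/-! ### Approximation by regular loads -/

theorem convex_loadSet (P : PowerNetwork nG nL nE) (ξ : SystemLimits nG nE) :
    Convex ℝ (P.loadSet ξ) := by
  rintro s₁ ⟨h₁, g₁, θ₁, hf₁⟩ s₂ ⟨h₂, g₂, θ₂, hf₂⟩ a b ha hb hab
  refine ⟨fun j => ?_, _, _, hf₁.convex_comb hf₂ ha hb hab⟩
  exact convex_Ioi (0 : ℝ) (h₁ j) (h₂ j) ha hb hab

theorem exists_isOptimal (hf : f ∈ P.costSet ξ) {sl : Fin nL → ℝ} (hsl : sl ∈ P.loadSet ξ) :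
    ∃ sg θ, P.IsOptimal ξ f sl sg θ := by
  obtain ⟨x, hx, -⟩ := (hf sl hsl).1
  exact ⟨x.1, x.2, hx⟩

/-- Feasibility is preserved under limits of loads and generations. -/
theorem Feasible.of_tendsto {s : ℕ → Fin nL → ℝ} {g : ℕ → Fin nG → ℝ}
    {θ : ℕ → Bus nG nL → ℝ} {s₀ : Fin nL → ℝ} {g₀ : Fin nG → ℝ}
    (hfeas : ∀ n, P.Feasible ξ (s n) (g n) (θ n)) (hs : Tendsto s atTop (𝓝 s₀))
    (hg : Tendsto g atTop (𝓝 g₀)) : ∃ θ₀, P.Feasible ξ s₀ g₀ θ₀ := by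
  have hr : Tendsto (fun n => (Sum.elim (g n) (fun j => - s n j) : Bus nG nL → ℝ)) atTop
      (𝓝 (Sum.elim g₀ (fun j => - s₀ j))) := by
    rw [tendsto_pi_nhds]
    rintro (i | j)
    · exact tendsto_pi_nhds.1 hg i
    · exact (tendsto_pi_nhds.1 hs j).neg
  have hθ : Tendsto θ atTop (𝓝 (P.angle (Sum.elim g₀ (fun j => - s₀ j)))) := by
    have : θ = fun n => P.angle (Sum.elim (g n) (fun j => - s n j)) :=
      funext fun n => (hfeas n).angle_eq
    rw [this]
    exact (P.continuous_angle.tendsto _).comp hr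
  have hp := (P.continuous_flow.tendsto _).comp hθ
  refine ⟨P.angle (Sum.elim g₀ (fun j => - s₀ j)), ?_, ?_, ?_, ?_, ?_, ?_⟩
  · have h0 := tendsto_pi_nhds.1 hθ P.slack
    simp only [(hfeas _).slack_angle] at h0
    exact tendsto_nhds_unique h0 tendsto_const_nhds
  · have hc : Continuous fun x : Bus nG nL → ℝ => P.laplacian *ᵥ x :=
      Continuous.matrix_mulVec continuous_const continuous_id
    have h0 := (hc.tendsto _).comp hθ
    refine tendsto_nhds_unique h0 ?_
    refine hr.congr fun n => ((hfeas n).balance).symm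
  · exact ge_of_tendsto' hg fun n => (hfeas n).gen_lower
  · exact le_of_tendsto' hg fun n => (hfeas n).gen_upper
  · exact ge_of_tendsto' hp fun n => (hfeas n).flow_lower
  · exact le_of_tendsto' hp fun n => (hfeas n).flow_upper

/-- The optimal generation at `α` is the limit of those along convex combinations of `α` with
feasible loads, whose weights at `α` tend to `1`. -/
theorem IsOptimal.tendsto_of_convex_comb (hf : f ∈ P.costSet ξ) {α : Fin nL → ℝ}
    (hα : α ∈ P.loadSet ξ) {a : Fin nG → ℝ} {θ : Bus nG nL → ℝ} (h : P.IsOptimal ξ f α a θ)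
    {w : ℕ → ℝ} (hw0 : ∀ n, 0 ≤ w n) (hw1 : ∀ n, w n ≤ 1) (hw : Tendsto w atTop (𝓝 0))
    {s : ℕ → Fin nL → ℝ} (hs : ∀ n, s n ∈ P.loadSet ξ) (hsb : Bornology.IsBounded (Set.range s))
    {g : ℕ → Fin nG → ℝ} {η : ℕ → Bus nG nL → ℝ}
    (hopt : ∀ n, P.IsOptimal ξ f ((1 - w n) • α + w n • s n) (g n) (η n)) :
    Tendsto g atTop (𝓝 a) := by
  have hbox : ∀ n, g n ∈ Set.Icc ξ.sgMin ξ.sgMax := fun n =>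
    ⟨(hopt n).1.gen_lower, (hopt n).1.gen_upper⟩
  have hfc : Continuous fun x : Fin nG → ℝ => f ⬝ᵥ x :=
    Continuous.dotProduct continuous_const continuous_id
  -- `M` bounds the cost over the whole generation box, hence at any feasible point for any `s n`.
  obtain ⟨M, hM⟩ := (isCompact_Icc (a := ξ.sgMin) (b := ξ.sgMax)).bddAbove_image
    (f := fun x => f ⬝ᵥ x) hfc.continuousOn
  have hcost : ∀ n, f ⬝ᵥ g n ≤ (1 - w n) * (f ⬝ᵥ a) + w n * M := by
    intro n
    -- Mixing `a` with a feasible `y` gives a competitor for the mixed load; this yields the upper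
    -- bound on optimal costs even if `α` is a boundary point.
    obtain ⟨-, y, κ, hy⟩ := hs n
    have h1 := (hopt n).2 _ _
      (h.1.convex_comb hy (sub_nonneg.2 (hw1 n)) (hw0 n) (sub_add_cancel _ _))
    rw [dotProduct_add, dotProduct_smul, dotProduct_smul, smul_eq_mul, smul_eq_mul] at h1
    have h2 : f ⬝ᵥ y ≤ M := hM ⟨y, ⟨hy.gen_lower, hy.gen_upper⟩, rfl⟩
    have := mul_le_mul_of_nonneg_left h2 (hw0 n)
    linarith
  have hload : Tendsto (fun n => (1 - w n) • α + w n • s n) atTop (𝓝 α) := by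
    obtain ⟨C, hC⟩ := hsb.exists_norm_le
    have h1 : Tendsto (fun n => w n • s n) atTop (𝓝 0) := by
      refine squeeze_zero_norm (a := fun n => w n * C) (fun n => ?_) ?_
      · rw [norm_smul, Real.norm_of_nonneg (hw0 n)]
        exact mul_le_mul_of_nonneg_left (hC _ ⟨n, rfl⟩) (hw0 n)
      · simpa using hw.mul_const C
    have h2 : Tendsto (fun n => (1 - w n) • α) atTop (𝓝 ((1 - 0 : ℝ) • α)) :=
      (tendsto_const_nhds.sub hw).smul_const α
    simpa using h2.add h1
  have hbound : Tendsto (fun n => (1 - w n) * (f ⬝ᵥ a) + w n * M) atTop (𝓝 (f ⬝ᵥ a)) := by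
    simpa using ((tendsto_const_nhds (x := (1 : ℝ)).sub hw).mul_const (f ⬝ᵥ a)).add
      (hw.mul_const M)
  -- Every limit point is feasible for `α` and costs at most as much as `a`, so by uniqueness it is
  -- `a`.
  refine tendsto_of_subseq_tendsto fun ns hns => ?_
  obtain ⟨x, -, φ, hφ, hx⟩ := isCompact_Icc.tendsto_subseq fun n => hbox (ns n)
  refine ⟨φ, ?_⟩
  have hsub : Tendsto (fun n => ns (φ n)) atTop atTop := hns.comp hφ.tendsto_atTop
  obtain ⟨θx, hfx⟩ := Feasible.of_tendsto (fun n => (hopt (ns (φ n))).1) (hload.comp hsub) hx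
  have hle : f ⬝ᵥ x ≤ f ⬝ᵥ a :=
    le_of_tendsto_of_tendsto' ((hfc.tendsto x).comp hx) (hbound.comp hsub)
      fun n => hcost (ns (φ n))
  have hxopt : P.IsOptimal ξ f α x θx := ⟨hfx, fun g' θ' h' => hle.trans (h.2 g' θ' h')⟩
  rw [(IsOptimal.eq_of_isOptimal hf hα h hxopt).1]
  exact hx

/-- Convex combinations of `α` with loads near an interior point may be chosen regular. -/
theorem exists_regular_convex_comb (hdense : P.loadSet ξ ⊆ closure (P.regularLoadSet ξ f))
    {α s : Fin nL → ℝ} (hα : α ∈ P.loadSet ξ) (hs : s ∈ P.loadSet ξ) {ρ : ℝ} (hρ : 0 < ρ)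
    {w : ℝ} (hw0 : 0 < w) (hw1 : w ≤ 1) :
    ∃ s' ∈ Metric.ball s ρ, (1 - w) • α + w • s' ∈ P.regularLoadSet ξ f := by
  have hmem := hdense (P.convex_loadSet ξ hα hs (sub_nonneg.2 hw1) hw0.le (sub_add_cancel _ _))
  -- Solving for `s'` divides the displacement by `w`, hence the tolerance `w * ρ`.
  obtain ⟨y, hy, hdist⟩ := Metric.mem_closure_iff.1 hmem (w * ρ) (mul_pos hw0 hρ)
  have hw' : w • (s + w⁻¹ • (y - ((1 - w) • α + w • s))) =
      w • s + (y - ((1 - w) • α + w • s)) := by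
    rw [smul_add, smul_inv_smul₀ hw0.ne']
  refine ⟨s + w⁻¹ • (y - ((1 - w) • α + w • s)), ?_, ?_⟩
  · rw [Metric.mem_ball, dist_eq_norm, add_sub_cancel_left, norm_smul, norm_inv,
      Real.norm_of_nonneg hw0.le, ← dist_eq_norm, dist_comm, inv_mul_lt_iff₀ hw0]
    exact hdist
  · rw [hw', ← add_assoc, add_sub_cancel]
    exact hy

theorem bindingBranches_subset_bridges
    (hbridge : P.bottlenecks ξ f ⊆ P.bridges) {sl : Fin nL → ℝ}
    (hsl : sl ∈ P.regularLoadSet ξ f) {sg : Fin nG → ℝ} {θ : Bus nG nL → ℝ}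
    (h : P.IsOptimal ξ f sl sg θ) : P.bindingBranches ξ θ ⊆ P.bridges :=
  fun _ he => hbridge ⟨sl, hsl, sg, θ, h, he⟩

end PowerNetwork

theorem mainTheorem8 {nG nL nE : ℕ} [NeZero nG] (P : PowerNetwork nG nL nE)
    (ξ : SystemLimits nG nE) (f : Fin nG → ℝ)
    (hwell : ξ.WellPosed)
    (hξ : ξ ∈ P.limitSet)
    (hf : f ∈ P.costSet ξ)
    (hdense : P.loadSet ξ ⊆ closure (P.regularLoadSet ξ f))
    (hbridge : P.bottlenecks ξ f ⊆ P.bridges) :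
    P.IsMonotone ξ f := by
  rintro α hα β hβ hβα - a ⟨θa, ha⟩ b ⟨θb, hb⟩
  obtain ⟨s₀, hs₀⟩ : (P.regularLoadSet ξ f).Nonempty :=
    closure_nonempty_iff.1 (hξ.2.mono hdense)
  obtain ⟨ρ, hρ, hball⟩ := Metric.mem_nhds_iff.1 (PowerNetwork.loadSet_mem_nhds hf hs₀)
  -- Balls of radius `ρ / 4` about `s₀` shifted by `±ρ / 4` in all coordinates stay in the feasible
  -- ball, and every point of the upper one dominates every point of the lower one.
  have hρ4 : 0 < ρ / 4 := by positivity
  have hshift : ∀ c : ℝ, |c| ≤ ρ / 4 →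
      Metric.ball (s₀ + fun _ => c) (ρ / 4) ⊆ Metric.ball s₀ ρ := by
    intro c hc
    refine Metric.ball_subset_ball' ?_
    rw [dist_eq_norm, add_sub_cancel_left]
    have : ‖fun _ : Fin nL => c‖ ≤ |c| := pi_norm_const_le c
    linarith
  have hup := hshift (ρ / 4) (abs_of_pos hρ4).le
  have hdown := hshift (-(ρ / 4)) (by rw [abs_neg, abs_of_pos hρ4])
  set w : ℕ → ℝ := fun n => 1 / ((n : ℝ) + 1) with hwdef
  have hw0 : ∀ n, 0 < w n := fun n => Nat.one_div_pos_of_nat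
  have hw1 : ∀ n, w n ≤ 1 := fun n => by
    rw [hwdef]
    exact div_le_one_of_le₀ (by linarith [n.cast_nonneg (α := ℝ)]) (by positivity)
  have hw : Filter.Tendsto w Filter.atTop (nhds 0) := tendsto_one_div_add_atTop_nhds_zero_nat
  choose u hu hureg using fun n => PowerNetwork.exists_regular_convex_comb hdense hα
    (hball (hup (Metric.mem_ball_self hρ4))) hρ4 (hw0 n) (hw1 n)
  choose v hv hvreg using fun n => PowerNetwork.exists_regular_convex_comb hdense hβ
    (hball (hdown (Metric.mem_ball_self hρ4))) hρ4 (hw0 n) (hw1 n)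
  choose ga θga hga using fun n => PowerNetwork.exists_isOptimal hf (hureg n).1
  choose gb θgb hgb using fun n => PowerNetwork.exists_isOptimal hf (hvreg n).1
  have hvu : ∀ n, v n ≤ u n := by
    intro n j
    have h1 := (dist_le_pi_dist (u n) _ j).trans_lt (Metric.mem_ball.1 (hu n))
    have h2 := (dist_le_pi_dist (v n) _ j).trans_lt (Metric.mem_ball.1 (hv n))
    rw [Real.dist_eq, abs_lt, Pi.add_apply] at h1 h2
    linarith [h1.1, h2.2]
  -- Equal weights on both sides preserve the order of the mixed loads, which are regular, so the
  -- exchange argument applies to them.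
  have hle : ∀ n, gb n ≤ ga n := by
    intro n
    refine PowerNetwork.IsOptimal.le_of_bridges hf (hureg n).1 ?_ (hga n) (hgb n)
      (PowerNetwork.bindingBranches_subset_bridges hbridge (hureg n) (hga n))
      (PowerNetwork.bindingBranches_subset_bridges hbridge (hvreg n) (hgb n))
    exact add_le_add (smul_le_smul_of_nonneg_left hβα (sub_nonneg.2 (hw1 n)))
      (smul_le_smul_of_nonneg_left (hvu n) (hw0 n).le)
  have hlima := ha.tendsto_of_convex_comb hf hα (fun n => (hw0 n).le) hw1 hw
    (fun n => hball (hup (hu n)))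
    (Metric.isBounded_ball.subset (Set.range_subset_iff.2 hu)) hga
  have hlimb := hb.tendsto_of_convex_comb hf hβ (fun n => (hw0 n).le) hw1 hw
    (fun n => hball (hdown (hv n)))
    (Metric.isBounded_ball.subset (Set.range_subset_iff.2 hv)) hgb
  exact le_of_tendsto_of_tendsto' hlimb hlima hle
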